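/- Let $M$ be a closed (compact, without boundary) smooth $n$-manifold; orientability and connectedness are not needed, so in particular $M$ may be any closed orientable $n$-manifold. Let $H^1(M;\mathbb R)$ be the first de Rham cohomology, i.e. closed smooth 1-forms modulo exact ones, with its standard topology as a finite-dimensional real vector space, and let $S(M)=(H^1(M;\mathbb R)\setminus\{0\})/\mathbb R_{+}$ be the space of rays with the quotient topology. A closed 1-form $\omega$ is *Morse* if every zero of $\omega$ is non-degenerate, i.e. near each zero $\omega=df$ with $f$ having non-singular Hessian there; the index of the zero is the index of this Hessian. For a Morse 1-form $\omega$ let $\widetilde m(\omega)=(m_0,\dots,m_n)\in\mathbb N^{n+1}$, where $m_i$ is the number of zeros of index $i$, and order $\mathbb N^{n+1}$ lexicographically. For $\xi\in H^1(M;\mathbb R)$ let $\widetilde m(\xi)$ be the minimum of $\widetilde m(\omega)$ over the Morse 1-forms $\omega$ with $[\omega]=\xi$; it depends only on the ray of $\xi\neq 0$ and gives the Morse complexity $m:S(M)\to\mathbb N^{n+1}$. Then every nonzero class is represented by a Morse 1-form, so the minimum that defines $m$ exists, and for each $\vec m\in\mathbb N^{n+1}$ there is an open subset $U\subset S(M)$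 such that $m(\psi)\le\vec m$ if and only if $\psi\in U$. Consequently $m$ is upper semi-continuous. Moreover $m(\psi)=\vec 0$ if and only if $\psi$ is represented by a closed 1-form without zeros, so the set of such rays is open in $S(M)$ (Tischler). -/

import Mathlib

open Set Filter Topology Bundle
open scoped Manifold ContDiff

noncomputable section

namespace MorseComplexity

variable (n : ℕ) (M : Type*) [TopologicalSpace M] [ChartedSpace (EuclideanSpace ℝ (Fin n)) M]
  [IsManifold (𝓡 n) ∞ M]

/-- Smooth 1-forms on `M`: smooth sections of the cotangent bundle. -/
abbrev OneForm : Type _ :=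
  ContMDiffSection (𝓡 n) (EuclideanSpace ℝ (Fin n) →L[ℝ] ℝ) ∞
    (fun x : M => TangentSpace (𝓡 n) x →L[ℝ] ℝ)

instance : AddCommGroup (OneForm n M) := inferInstance

instance : Module ℝ (OneForm n M) := inferInstance

instance : MulAction ℝ (OneForm n M) := inferInstance

variable {n M}

/-- The 1-form `α` written in the coordinates of the preferred chart around `c`: its pullback
under the inverse of the chart, a map from `ℝⁿ` to the dual of `ℝⁿ` (meaningful on the target of
the chart).  If `α = ∑ aᵢ dxᵢ` in this chart then `coord α c y v = ∑ aᵢ(y) vᵢ`. -/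
def coord (α : OneForm n M) (c : M) (y : EuclideanSpace ℝ (Fin n)) :
    EuclideanSpace ℝ (Fin n) →L[ℝ] ℝ :=
  (α ((extChartAt (𝓡 n) c).symm y)).comp
    (mfderiv 𝓘(ℝ, EuclideanSpace ℝ (Fin n)) (𝓡 n) (extChartAt (𝓡 n) c).symm y)

lemma coord_add (α β : OneForm n M) (c : M) : coord (α + β) c = coord α c + coord β c := by
  ext y v
  rfl

lemma coord_smul (r : ℝ) (α : OneForm n M) (c : M) : coord (r • α) c = r • coord α c := by
  ext y v
  rfl

lemma coord_zero (c : M) : coord (0 : OneForm n M) c = 0 := by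
  ext y v
  rfl

lemma differentiableAt_coord (α : OneForm n M) (c : M) {y : EuclideanSpace ℝ (Fin n)}
    (hy : y ∈ (extChartAt (𝓡 n) c).target) : DifferentiableAt ℝ (coord α c) y := by
  have hx : (extChartAt (𝓡 n) c).symm y ∈ (chartAt (EuclideanSpace ℝ (Fin n)) c).source := by
    simpa using (extChartAt (𝓡 n) c).map_target hy
  have h1 := (Trivialization.contMDiffAt_section_iff (IB := 𝓡 n) (n := ∞)
    (e := trivializationAt (EuclideanSpace ℝ (Fin n) →L[ℝ] ℝ)
      (fun x : M => TangentSpace (𝓡 n) x →L[ℝ] ℝ) c)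
    (s := fun x => α x) (x₀ := (extChartAt (𝓡 n) c).symm y) (by simpa using hx)).1
      (α.contMDiff _)
  have h2 : ContMDiffAt 𝓘(ℝ, EuclideanSpace ℝ (Fin n)) (𝓡 n) ∞ (extChartAt (𝓡 n) c).symm y :=
    (contMDiffOn_extChartAt_symm c).contMDiffAt ((isOpen_extChartAt_target c).mem_nhds hy)
  have h3 := (h1.comp y h2).contDiffAt.differentiableAt (by simp)
  refine h3.congr_of_eventuallyEq ?_
  filter_upwards [(isOpen_extChartAt_target (I := 𝓡 n) c).mem_nhds hy] with z hz
  have hz' : (extChartAt (𝓡 n) c).symm z ∈ (chartAt (EuclideanSpace ℝ (Fin n)) c).source := by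
    simpa using (extChartAt (𝓡 n) c).map_target hz
  have h4 := TangentBundle.symmL_trivializationAt (I := 𝓡 n) (x₀ := c) hz'
  rw [(extChartAt (𝓡 n) c).right_inv hz] at h4
  simp only [Function.comp_apply, hom_trivializationAt_apply, ContinuousLinearMap.inCoordinates]
  rw [h4]
  ext v
  simp [coord]

variable (n M) in
/-- The real vector space of closed smooth 1-forms: `dα = 0`, that is, in every chart the
coefficients satisfy `∂aᵢ/∂xⱼ = ∂aⱼ/∂xᵢ`. -/
def closedForms : Submodule ℝ (OneForm n M) where
  carrier := {α | ∀ c : M, ∀ y ∈ (extChartAt (𝓡 n) c).target, ∀ v w,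
    fderiv ℝ (coord α c) y v w = fderiv ℝ (coord α c) y w v}
  add_mem' := by
    intro α β hα hβ c y hy v w
    rw [coord_add, fderiv_add (differentiableAt_coord α c hy) (differentiableAt_coord β c hy)]
    simp [hα c y hy v w, hβ c y hy v w]
  zero_mem' := by
    intro c y _ v w
    simp [coord_zero]
  smul_mem' := by
    intro r α hα c y hy v w
    rw [coord_smul, fderiv_const_smul (differentiableAt_coord α c hy)]
    simp [hα c y hy v w]

variable (n M) in
/-- The subspace of exact forms `df`, with `f` a smooth function on `M`. -/
def exactForms : Submodule ℝ (closedForms n M) where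
  carrier := {α | ∃ f : M → ℝ, ContMDiff (𝓡 n) 𝓘(ℝ, ℝ) ∞ f ∧
    ∀ x, (α : OneForm n M) x = mfderiv (𝓡 n) 𝓘(ℝ, ℝ) f x}
  add_mem' := by
    rintro α β ⟨f, hf, hα⟩ ⟨g, hg, hβ⟩
    refine ⟨f + g, hf.add hg, fun x => ?_⟩
    rw [mfderiv_add (hf.mdifferentiableAt (by simp)) (hg.mdifferentiableAt (by simp)),
      ← hα x, ← hβ x]
    rfl
  zero_mem' := by
    refine ⟨fun _ => 0, contMDiff_const, fun x => ?_⟩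
    rw [mfderiv_const]
    rfl
  smul_mem' := by
    rintro r α ⟨f, hf, hα⟩
    refine ⟨r • f, by
      exact (contMDiff_const (c := r)).mul hf, fun x => ?_⟩
    rw [const_smul_mfderiv (hf.mdifferentiableAt (by simp)), ← hα x]
    rfl

variable (n M) in
/-- The first de Rham cohomology `H¹(M; ℝ)`: closed 1-forms modulo exact ones. -/
abbrev H1 : Type _ := closedForms n M ⧸ exactForms n M

/-- `H¹(M; ℝ)` carries the module topology, the finest one that makes it a topological vector
space over `ℝ`; on a finite-dimensional space this is the standard topology. -/
instance : TopologicalSpace (H1 n M) := moduleTopology ℝ (H1 n M)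

variable (n M) in
/-- `S(M) = (H¹(M; ℝ) \ {0}) / ℝ₊`, the space of rays in `H¹(M; ℝ)`. -/
abbrev S : Type _ := Module.Ray ℝ (H1 n M)

/-- `S(M)` has the quotient topology of the subspace topology on the nonzero vectors. -/
instance : TopologicalSpace (S n M) :=
  TopologicalSpace.coinduced
    (fun v : {v : H1 n M // v ≠ 0} => rayOfNeZero ℝ v.1 v.2) inferInstance

/-- The Hessian at a point `z` (of interest when `α z = 0`), in the coordinates of the preferred
chart at `z`: the matrix `∂aⱼ/∂xᵢ`.  If `α = df` near `z`, this is the Hessian of `f`. -/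
def hessian (α : OneForm n M) (z : M) : LinearMap.BilinForm ℝ (EuclideanSpace ℝ (Fin n)) :=
  (fderiv ℝ (coord α z) (extChartAt (𝓡 n) z z)).toBilinForm

/-- A closed 1-form is Morse if all its zeros are non-degenerate. -/
def IsMorse (α : closedForms n M) : Prop :=
  ∀ z : M, (α : OneForm n M) z = 0 → (hessian (α : OneForm n M) z).Nondegenerate

/-- The Morse index at `z`: the maximal dimension of a subspace on which the Hessian is negative
definite. -/
def morseIndex (α : closedForms n M) (z : M) : ℕ :=
  sigNeg (hessian (α : OneForm n M) z).toQuadraticMap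

/-- The complexity vector `(m₀, …, mₙ)` of a form, with `mᵢ` the number of zeros of index `i`,
in `ℕⁿ⁺¹` with the lexicographic order. -/
def complexityVector (α : closedForms n M) : Lex (Fin (n + 1) → ℕ) :=
  toLex fun i => Set.ncard {z : M | (α : OneForm n M) z = 0 ∧ morseIndex α z = i}

/-- The complexity vectors of the Morse 1-forms that represent the class `ξ`. -/
def morseVectors (ξ : H1 n M) : Set (Lex (Fin (n + 1) → ℕ)) :=
  {v | ∃ α : closedForms n M, IsMorse α ∧ (exactForms n M).mkQ α = ξ ∧ complexityVector α = v}

open Classical in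
/-- The complexity of a class: the lexicographic minimum of the complexity vectors of the Morse
1-forms that represent it. -/
def classComplexity (ξ : H1 n M) : Lex (Fin (n + 1) → ℕ) :=
  if h : (morseVectors ξ).Nonempty then wellFounded_lt.min (morseVectors ξ) h else 0

lemma hessian_smul (r : ℝ) (α : OneForm n M) (z : M) : hessian (r • α) z = r • hessian α z := by
  have h : DifferentiableAt ℝ (coord α z) (extChartAt (𝓡 n) z z) :=
    differentiableAt_coord α z (mem_extChartAt_target z)
  rw [hessian, coord_smul, fderiv_const_smul h]
  rfl

lemma sigNeg_le_smul {V : Type*} [AddCommGroup V] [Module ℝ V] [Module.Finite ℝ V]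
    (Q : QuadraticForm ℝ V) {r : ℝ} (hr : 0 < r) : sigNeg Q ≤ sigNeg (r • Q) := by
  obtain ⟨W, hW, hd⟩ := exists_finrank_eq_sigNeg_and_negDef Q
  rw [← hW]
  refine le_sigNeg_of_negDef (r • Q) fun x hx => ?_
  have := hd x hx
  simp only [QuadraticMap.restrict_apply, neg_apply, smul_apply,
    smul_eq_mul] at this ⊢
  nlinarith

lemma sigNeg_smul {V : Type*} [AddCommGroup V] [Module ℝ V] [Module.Finite ℝ V]
    (Q : QuadraticForm ℝ V) {r : ℝ} (hr : 0 < r) : sigNeg (r • Q) = sigNeg Q := by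
  refine le_antisymm ?_ (sigNeg_le_smul Q hr)
  simpa [smul_smul, inv_mul_cancel₀ hr.ne'] using sigNeg_le_smul (r • Q) (inv_pos.2 hr)

lemma smul_form_eq_zero (α : closedForms n M) {r : ℝ} (hr : 0 < r) (z : M) :
    ((r • α : closedForms n M) : OneForm n M) z = 0 ↔ (α : OneForm n M) z = 0 := by
  change r • (α : OneForm n M) z = 0 ↔ _
  simp [hr.ne']

lemma IsMorse.smul {α : closedForms n M} (h : IsMorse α) {r : ℝ} (hr : 0 < r) :
    IsMorse (r • α) := by
  intro z hz
  have h1 := h z ((smul_form_eq_zero α hr z).1 hz)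
  rw [Submodule.coe_smul, hessian_smul]
  exact ⟨fun x hx => h1.1 x fun y => by simpa [hr.ne'] using hx y,
    fun y hy => h1.2 y fun x => by simpa [hr.ne'] using hy x⟩

lemma complexityVector_smul (α : closedForms n M) {r : ℝ} (hr : 0 < r) :
    complexityVector (r • α) = complexityVector α := by
  have h (z : M) : morseIndex (r • α) z = morseIndex α z := by
    rw [morseIndex, Submodule.coe_smul, hessian_smul, LinearMap.BilinMap.toQuadraticMap_smul,
      sigNeg_smul _ hr, morseIndex]
  simp only [complexityVector, smul_form_eq_zero α hr, h]

lemma morseVectors_subset_smul (ξ : H1 n M) {r : ℝ} (hr : 0 < r) :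
    morseVectors ξ ⊆ morseVectors (r • ξ) := by
  rintro _ ⟨α, hα, rfl, rfl⟩
  exact ⟨r • α, hα.smul hr, map_smul _ _ _, complexityVector_smul α hr⟩

lemma morseVectors_smul (ξ : H1 n M) {r : ℝ} (hr : 0 < r) :
    morseVectors (r • ξ) = morseVectors ξ := by
  refine Subset.antisymm ?_ (morseVectors_subset_smul ξ hr)
  simpa [smul_smul, inv_mul_cancel₀ hr.ne'] using
    morseVectors_subset_smul (r • ξ) (inv_pos.2 hr)

lemma classComplexity_congr {ξ ξ' : H1 n M} (h : morseVectors ξ = morseVectors ξ') :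
    classComplexity ξ = classComplexity ξ' := by
  unfold classComplexity
  congr!

variable (n M) in
/-- The Morse complexity function `m : S(M) → ℕⁿ⁺¹`: the complexity of any class on the ray. -/
def morseComplexity : S n M → Lex (Fin (n + 1) → ℕ) :=
  Quotient.lift (fun v : RayVector ℝ (H1 n M) => classComplexity (v : H1 n M)) (by
    intro v w h
    obtain ⟨r, s, hr, hs, e⟩ := SameRay.exists_pos (show SameRay ℝ (v : H1 n M) w from h) v.2 w.2
    apply classComplexity_congr
    rw [← morseVectors_smul _ hr, e, morseVectors_smul _ hs])

end MorseComplexity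

end

/-! Existence. Where a bump function `b` of a chart is 1, adding the exact form `d (b ⟪e, x⟫)`
shifts the coefficient field by the constant covector `⟪e, ·⟫` and leaves its derivative alone. By
Sard's theorem, arbitrarily small `e` make every zero there non-degenerate. Being Morse on a compact
set is a `C¹`-open condition, so a small `e` does not spoil what was achieved before, and
compactness of `M` finishes the argument (`exists_isMorse`). The minimum exists because the
lexicographic order is well-founded.

Stability. Near a non-degenerate zero, a `C¹`-close closed form has at most one zero, non-degenerate
and of the same index; near a non-zero it has none. Over a finite cover this injects the new zeros
into the old ones index by index (`eventually_isMorse_and_complexityVector_le`).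

Openness. Take a minimizer `α` in the class `ξ₀` and a linear section `σ` of the projection from
closed forms to `H¹`. Then `α + σ (ξ - ξ₀)` represents `ξ` and is `C¹`-close to `α` for `ξ` near
`ξ₀`, so sublevel sets are open in `H¹`, hence in the space of rays. The Tischler statement is the
sublevel set of the least vector 0, which a Morse form attains exactly when it has no zeros. -/

noncomputable section

namespace MorseComplexity

/-! ### Inertia indices and injectivity under small perturbations -/

section LinearAlgebra

variable {V : Type*} [NormedAddCommGroup V] [NormedSpace ℝ V]

instance : SeminormedAddCommGroup (V →L[ℝ] V →L[ℝ] ℝ) :=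
  ContinuousLinearMap.toSeminormedAddCommGroup

instance : AddCommGroup (V →L[ℝ] V →L[ℝ] ℝ) := ContinuousLinearMap.addCommGroup

instance : AddGroup (V →L[ℝ] V →L[ℝ] ℝ) := AddCommGroup.toAddGroup

instance : IsTopologicalAddGroup (V →L[ℝ] V →L[ℝ] ℝ) :=
  SeminormedAddCommGroup.toIsTopologicalAddGroup

instance : ContinuousAdd (V →L[ℝ] V →L[ℝ] ℝ) := IsTopologicalAddGroup.toContinuousAdd

/-- The positive index of inertia is lower semicontinuous. -/
lemma eventually_sigPos_le [FiniteDimensional ℝ V] (B₀ : V →L[ℝ] V →L[ℝ] ℝ) :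
    ∀ᶠ B in 𝓝 B₀, sigPos B₀.toBilinForm.toQuadraticMap ≤ sigPos B.toBilinForm.toQuadraticMap := by
  obtain ⟨W, hW, hd⟩ := exists_finrank_eq_sigPos_and_posDef B₀.toBilinForm.toQuadraticMap
  have hK : IsCompact ((W : Set V) ∩ Metric.sphere 0 1) :=
    (isCompact_sphere 0 1).inter_left W.closed_of_finiteDimensional
  -- Positivity on the compact unit sphere of a maximal positive subspace `W` is an open condition
  -- on the form; homogeneity then extends it to all of `W`.
  have key : ∀ᶠ B in 𝓝 B₀, ∀ x ∈ (W : Set V) ∩ Metric.sphere 0 1, 0 < B x x := by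
    refine hK.eventually_forall_of_forall_eventually fun x hx => ?_
    have hc : Continuous fun z : (V →L[ℝ] V →L[ℝ] ℝ) × V => z.1 z.2 z.2 := by fun_prop
    refine hc.continuousAt.eventually (lt_mem_nhds ?_)
    have hx0 : (⟨x, hx.1⟩ : W) ≠ 0 := by
      intro h
      have h0 : x = 0 := congrArg Subtype.val h
      simpa [h0] using hx.2
    simpa using hd _ hx0
  filter_upwards [key] with B hB
  rw [← hW]
  refine le_sigPos_of_posDef _ fun x hx => ?_
  have hn : 0 < ‖(x : V)‖ := by simpa using hx
  have h1 := hB (‖(x : V)‖⁻¹ • (x : V)) ⟨W.smul_mem _ x.2, by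
    simp [norm_smul, hn.ne']⟩
  simp only [map_smul, smul_apply, smul_eq_mul] at h1
  have h2 : 0 < ‖(x : V)‖⁻¹ := inv_pos.2 hn
  have h3 := (pos_iff_pos_of_mul_pos h1).1 h2
  simpa using (pos_iff_pos_of_mul_pos h3).1 h2

/-- The negative index of inertia is lower semicontinuous. -/
lemma eventually_sigNeg_le [FiniteDimensional ℝ V] (B₀ : V →L[ℝ] V →L[ℝ] ℝ) :
    ∀ᶠ B in 𝓝 B₀, sigNeg B₀.toBilinForm.toQuadraticMap ≤ sigNeg B.toBilinForm.toQuadraticMap := by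
  have h : ∀ B : V →L[ℝ] V →L[ℝ] ℝ,
      sigNeg B.toBilinForm.toQuadraticMap = sigPos (-B).toBilinForm.toQuadraticMap := fun B => by
    rw [← sigPos_neg]
    congr 1
  simp only [h]
  have hc : Tendsto (fun B : V →L[ℝ] V →L[ℝ] ℝ => -B) (𝓝 B₀) (𝓝 (-B₀)) := tendsto_id.neg
  exact hc.eventually (eventually_sigPos_le (-B₀))

lemma nondegenerate_iff_of_symm {B : V →L[ℝ] V →L[ℝ] ℝ} (hB : ∀ v w, B v w = B w v) :
    B.toBilinForm.Nondegenerate ↔ Function.Injective B := by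
  constructor
  · intro h
    refine (injective_iff_map_eq_zero B).2 fun v hv => h.1 v fun w => ?_
    simp [hv]
  · intro h
    have hl : ∀ v, (∀ w, B v w = 0) → v = 0 := fun v hv =>
      (injective_iff_map_eq_zero B).1 h v (by ext w; exact hv w)
    exact ⟨fun v hv => hl v hv, fun v hv => hl v fun w => by rw [hB]; exact hv w⟩

/-- The radical vanishes: `B v v = 0` and `B (v + w) (v + w) = B w w` polarize to `B v w = 0` for
all `w`. -/
lemma sigPos_add_sigNeg_of_injective [FiniteDimensional ℝ V] {B : V →L[ℝ] V →L[ℝ] ℝ}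
    (hB : ∀ v w, B v w = B w v) (hinj : Function.Injective B) :
    sigPos B.toBilinForm.toQuadraticMap + sigNeg B.toBilinForm.toQuadraticMap =
      Module.finrank ℝ V := by
  rw [← QuadraticForm.sigPos_add_sigNeg_add_radical (Q := B.toBilinForm.toQuadraticMap)]
  have : B.toBilinForm.toQuadraticMap.radical = ⊥ := by
    refine (Submodule.eq_bot_iff _).2 fun v hv => ?_
    obtain ⟨h0, h1⟩ := QuadraticMap.mem_radical_iff'.1 hv
    refine (injective_iff_map_eq_zero B).1 hinj v (by
      ext w
      have h2 := h1 w
      have h3 : B v v = 0 := h0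
      change B (v + w) (v + w) = B w w at h2
      simp only [map_add, add_apply] at h2
      have := hB v w
      simp only [zero_apply]
      linarith)
  simp [this]

/-- The index of a non-degenerate symmetric form is locally constant. -/
lemma eventually_sigNeg_eq [FiniteDimensional ℝ V] {B₀ : V →L[ℝ] V →L[ℝ] ℝ}
    (h₀ : ∀ v w, B₀ v w = B₀ w v)
    (hinj : Function.Injective B₀) :
    ∀ᶠ B in 𝓝 B₀, sigNeg B.toBilinForm.toQuadraticMap = sigNeg B₀.toBilinForm.toQuadraticMap := by
  -- Neither index can drop near `B₀`, and their sum cannot exceed the dimension, which it already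
  -- equals at `B₀`; so both are constant.
  filter_upwards [eventually_sigPos_le B₀, eventually_sigNeg_le B₀] with B h1 h2
  have h3 := sigPos_add_sigNeg_of_injective h₀ hinj
  have h4 := QuadraticForm.sigPos_add_sigNeg_add_radical (Q := B.toBilinForm.toQuadraticMap)
  omega

lemma exists_forall_norm_le_of_injective [FiniteDimensional ℝ V] {G : Type*} [NormedAddCommGroup G]
    [NormedSpace ℝ G]
    {B : V →L[ℝ] G} (hinj : Function.Injective B) : ∃ c > 0, ∀ v, c * ‖v‖ ≤ ‖B v‖ := by
  obtain ⟨K, hK, h⟩ := LinearMap.exists_antilipschitzWith (B : V →ₗ[ℝ] G)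
    (LinearMap.ker_eq_bot.2 hinj)
  refine ⟨(K : ℝ)⁻¹, by positivity, fun v => ?_⟩
  have := h.le_mul_dist v 0
  simp only [dist_zero_right, map_zero] at this
  have hK' : (0 : ℝ) < K := hK
  rw [inv_mul_le_iff₀ hK']
  simpa using this

/-- Injectivity persists under perturbations, also for maps with a `C¹`-close derivative. -/
lemma exists_injective_of_dist_le [FiniteDimensional ℝ V] {G : Type*} [NormedAddCommGroup G]
    [NormedSpace ℝ G]
    {B₀ : V →L[ℝ] G} (hinj : Function.Injective B₀) :
    ∃ ε > 0, (∀ B : V →L[ℝ] G, ‖B - B₀‖ ≤ ε → Function.Injective B) ∧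
      ∀ (f : V → G) (s : Set V), Convex ℝ s → (∀ y ∈ s, DifferentiableAt ℝ f y) →
        (∀ y ∈ s, ‖fderiv ℝ f y - B₀‖ ≤ ε) → InjOn f s := by
  obtain ⟨c, hc, h⟩ := exists_forall_norm_le_of_injective hinj
  have aux : ∀ v : V, c * ‖v‖ ≤ c / 2 * ‖v‖ → v = 0 := fun v hv => by
    by_contra hne
    have := norm_pos_iff.2 hne
    nlinarith
  -- Any bound below the expansion constant `c` of `B₀` works: an error of at most `c / 2 * ‖v‖`
  -- cannot cancel `B₀ v` unless `v = 0`.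
  refine ⟨c / 2, by positivity, fun B hB => ?_, fun f s hs hf hB x hx y hy hxy => ?_⟩
  · refine (injective_iff_map_eq_zero B).2 fun v hv => aux v ((h v).trans ?_)
    calc ‖B₀ v‖ = ‖(B - B₀) v‖ := by simp [hv]
      _ ≤ c / 2 * ‖v‖ := (B - B₀).le_of_opNorm_le hB v
  -- Mean value inequality for `f - B₀` on the convex set `s`.
  · have h1 := hs.norm_image_sub_le_of_norm_hasFDerivWithin_le'
      (fun z hz => (hf z hz).hasFDerivAt.hasFDerivWithinAt) hB hy hx
    rw [hxy, sub_self, zero_sub, norm_neg] at h1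
    exact sub_eq_zero.1 (aux _ ((h _).trans h1))

end LinearAlgebra

/-! ### Sard's theorem and uniform neighbourhoods -/

/-- Sard's theorem for covector fields: for almost every `e` the field `A + ⟪e, ·⟫` has only
non-degenerate zeros. -/
lemma dense_forall_injective_fderiv {E : Type*} [NormedAddCommGroup E] [InnerProductSpace ℝ E]
    [FiniteDimensional ℝ E] {A : E → E →L[ℝ] ℝ} {s : Set E}
    (hA : ∀ y ∈ s, DifferentiableAt ℝ A y) :
    Dense {e : E | ∀ y ∈ s, A y + innerSL ℝ e = 0 → Function.Injective (fderiv ℝ A y)} := by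
  borelize E
  let J : E ≃L[ℝ] (E →L[ℝ] ℝ) := LinearEquiv.toContinuousLinearEquiv
    { (InnerProductSpace.toDual ℝ E).toEquiv with
      map_add' := fun x y => map_add (InnerProductSpace.toDual ℝ E) x y
      map_smul' := fun r x => by
        simp [InnerProductSpace.toDual] }
  set g : E → E := fun y => J.symm (A y) with hg
  have hgd : ∀ y ∈ s, HasFDerivAt g ((J.symm : (E →L[ℝ] ℝ) →L[ℝ] E) ∘L fderiv ℝ A y) y :=
    fun y hy => (J.symm : (E →L[ℝ] ℝ) →L[ℝ] E).hasFDerivAt.comp y (hA y hy).hasFDerivAt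
  -- The critical points of `g`, the field `A` turned into a vector field by Riesz duality. A zero
  -- of `A + ⟪e, ·⟫` is a solution of `g y = -e`, so the bad `e` are the negatives of the critical
  -- values.
  set t := {y ∈ s | ((J.symm : (E →L[ℝ] ℝ) →L[ℝ] E) ∘L fderiv ℝ A y).det = 0} with ht
  have h0 : MeasureTheory.volume (g '' t) = 0 :=
    MeasureTheory.addHaar_image_eq_zero_of_det_fderivWithin_eq_zero _
      (fun y hy => (hgd y hy.1).hasFDerivWithinAt) fun y hy => hy.2
  have h1 : MeasureTheory.volume (Neg.neg ⁻¹' (g '' t)) = 0 := by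
    rwa [MeasureTheory.Measure.measure_preimage_neg]
  refine (MeasureTheory.Measure.dense_of_ae (μ := MeasureTheory.volume)
    (p := fun e => e ∉ Neg.neg ⁻¹' (g '' t)) (MeasureTheory.measure_eq_zero_iff_ae_notMem.1 h1)).mono
    fun e he y hy hz => ?_
  have hAy : A y = innerSL ℝ (-e) := by
    rw [map_neg]; exact eq_neg_of_add_eq_zero_left hz
  have hgy : g y = -e := by
    rw [hg]
    change J.symm (A y) = -e
    rw [hAy, ContinuousLinearEquiv.symm_apply_eq]
    rfl
  have hdet : ((J.symm : (E →L[ℝ] ℝ) →L[ℝ] E) ∘L fderiv ℝ A y).det ≠ 0 := fun hd =>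
    he ⟨y, ⟨hy, hd⟩, hgy⟩
  have hinj := (LinearMap.equivOfDetNeZero _ hdet).injective
  intro v w hvw
  exact hinj (congrArg J.symm hvw)

/-- A product neighbourhood gives a coordinate ball independent of the parameter. A ball is used
because the injectivity criterion needs a convex set. -/
lemma exists_ball_eventually_forall {n : ℕ} {M W : Type*} [TopologicalSpace M]
    [ChartedSpace (EuclideanSpace ℝ (Fin n)) M] [TopologicalSpace W] {w₀ : W}
    {P : W × EuclideanSpace ℝ (Fin n) → Prop} {x : M}
    (h : ∀ᶠ p in 𝓝 (w₀, extChartAt (𝓡 n) x x), P p) :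
    ∃ r, Metric.ball (extChartAt (𝓡 n) x x) r ⊆ (extChartAt (𝓡 n) x).target ∧
      (extChartAt (𝓡 n) x).source ∩ extChartAt (𝓡 n) x ⁻¹'
        Metric.ball (extChartAt (𝓡 n) x x) r ∈ 𝓝 x ∧
      ∀ᶠ w in 𝓝 w₀, ∀ y ∈ Metric.ball (extChartAt (𝓡 n) x x) r, P (w, y) := by
  rw [nhds_prod_eq] at h
  obtain ⟨pa, ha, pb, hb, hab⟩ := eventually_prod_iff.1 h
  obtain ⟨r, hr, hball⟩ := Metric.mem_nhds_iff.1 (inter_mem hb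
    ((isOpen_extChartAt_target (I := 𝓡 n) x).mem_nhds (mem_extChartAt_target x)))
  refine ⟨r, fun y hy => (hball hy).2, inter_mem (extChartAt_source_mem_nhds x)
    ((continuousAt_extChartAt x).preimage_mem_nhds (Metric.ball_mem_nhds _ hr)), ?_⟩
  filter_upwards [ha] with w hw y hy
  exact hab hw (hball hy).1

variable {n : ℕ} {M : Type*} [TopologicalSpace M] [ChartedSpace (EuclideanSpace ℝ (Fin n)) M]
  [IsManifold (𝓡 n) ∞ M]

/-! ### Forms in charts and change of coordinates -/

section Coordinates

/-- On the chart target, `coord α c` agrees with the section read in the bundle trivialization at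
`c`, which is smooth. -/
lemma contDiffAt_coord (α : OneForm n M) (c : M) {y : EuclideanSpace ℝ (Fin n)}
    (hy : y ∈ (extChartAt (𝓡 n) c).target) : ContDiffAt ℝ ∞ (coord α c) y := by
  have hx : (extChartAt (𝓡 n) c).symm y ∈ (chartAt (EuclideanSpace ℝ (Fin n)) c).source := by
    simpa using (extChartAt (𝓡 n) c).map_target hy
  have h1 := (Trivialization.contMDiffAt_section_iff (IB := 𝓡 n) (n := ∞)
    (e := trivializationAt (EuclideanSpace ℝ (Fin n) →L[ℝ] ℝ)
      (fun x : M => TangentSpace (𝓡 n) x →L[ℝ] ℝ) c)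
    (s := fun x => α x) (x₀ := (extChartAt (𝓡 n) c).symm y) (by simpa using hx)).1
      (α.contMDiff _)
  have h2 : ContMDiffAt 𝓘(ℝ, EuclideanSpace ℝ (Fin n)) (𝓡 n) ∞ (extChartAt (𝓡 n) c).symm y :=
    (contMDiffOn_extChartAt_symm c).contMDiffAt ((isOpen_extChartAt_target c).mem_nhds hy)
  have h3 := (h1.comp y h2).contDiffAt
  refine h3.congr_of_eventuallyEq ?_
  filter_upwards [(isOpen_extChartAt_target (I := 𝓡 n) c).mem_nhds hy] with z hz
  have hz' : (extChartAt (𝓡 n) c).symm z ∈ (chartAt (EuclideanSpace ℝ (Fin n)) c).source := by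
    simpa using (extChartAt (𝓡 n) c).map_target hz
  have h4 := TangentBundle.symmL_trivializationAt (I := 𝓡 n) (x₀ := c) hz'
  rw [(extChartAt (𝓡 n) c).right_inv hz] at h4
  simp only [Function.comp_apply, hom_trivializationAt_apply, ContinuousLinearMap.inCoordinates]
  rw [h4]
  ext v
  simp [coord]

lemma continuousOn_coord (α : OneForm n M) (c : M) :
    ContinuousOn (coord α c) (extChartAt (𝓡 n) c).target :=
  fun _ hy => (contDiffAt_coord α c hy).continuousAt.continuousWithinAt

lemma continuousOn_fderiv_coord (α : OneForm n M) (c : M) :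
    ContinuousOn (fderiv ℝ (coord α c)) (extChartAt (𝓡 n) c).target := fun _ hy =>
  ((contDiffAt_coord α c hy).fderiv_right (m := ∞) (by simp)).continuousAt.continuousWithinAt

lemma exists_equiv_eq_mfderiv_extChartAt_symm {c : M} {y : EuclideanSpace ℝ (Fin n)}
    (hy : y ∈ (extChartAt (𝓡 n) c).target) :
    ∃ L : EuclideanSpace ℝ (Fin n) ≃L[ℝ] EuclideanSpace ℝ (Fin n),
      (L : EuclideanSpace ℝ (Fin n) →L[ℝ] EuclideanSpace ℝ (Fin n)) =
        mfderiv 𝓘(ℝ, EuclideanSpace ℝ (Fin n)) (𝓡 n) (extChartAt (𝓡 n) c).symm y := by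
  have h := isInvertible_mfderivWithin_extChartAt_symm (I := 𝓡 n) hy
  rw [ModelWithCorners.range_eq_univ, mfderivWithin_univ] at h
  exact h

lemma coord_eq_zero_iff (α : OneForm n M) {c : M} {y : EuclideanSpace ℝ (Fin n)}
    (hy : y ∈ (extChartAt (𝓡 n) c).target) :
    coord α c y = 0 ↔ α ((extChartAt (𝓡 n) c).symm y) = 0 := by
  obtain ⟨L, hL⟩ := exists_equiv_eq_mfderiv_extChartAt_symm hy
  let a : M → EuclideanSpace ℝ (Fin n) →L[ℝ] ℝ := fun x => α x
  have h1 : coord α c y = (a ((extChartAt (𝓡 n) c).symm y)).comp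
      (L : EuclideanSpace ℝ (Fin n) →L[ℝ] EuclideanSpace ℝ (Fin n)) := by
    rw [hL]; rfl
  rw [h1]
  change _ ↔ a _ = 0
  constructor
  · intro h
    ext v
    have h1 := congrArg (fun f => f (L.symm v)) h
    simpa using h1
  · intro h
    rw [h, ContinuousLinearMap.zero_comp]

/-- The coordinate change from the chart at `c` to the chart at `z`. -/
abbrev transition (n : ℕ) {M : Type*} [TopologicalSpace M]
    [ChartedSpace (EuclideanSpace ℝ (Fin n)) M] (c z : M) :
    EuclideanSpace ℝ (Fin n) → EuclideanSpace ℝ (Fin n) :=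
  extChartAt (𝓡 n) z ∘ (extChartAt (𝓡 n) c).symm

lemma mdifferentiableAt_extChartAt_symm {c : M} {y : EuclideanSpace ℝ (Fin n)}
    (hy : y ∈ (extChartAt (𝓡 n) c).target) :
    MDifferentiableAt 𝓘(ℝ, EuclideanSpace ℝ (Fin n)) (𝓡 n) (extChartAt (𝓡 n) c).symm y :=
  ((contMDiffOn_extChartAt_symm (n := ∞) c).contMDiffAt
    ((isOpen_extChartAt_target c).mem_nhds hy)).mdifferentiableAt (by simp)

lemma contDiffAt_transition {c z : M} {y : EuclideanSpace ℝ (Fin n)}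
    (hy : y ∈ (extChartAt (𝓡 n) c).target)
    (hz : (extChartAt (𝓡 n) c).symm y ∈ (extChartAt (𝓡 n) z).source) :
    ContDiffAt ℝ ∞ (transition n c z) y := by
  have h2 : ContMDiffAt 𝓘(ℝ, EuclideanSpace ℝ (Fin n)) (𝓡 n) ∞ (extChartAt (𝓡 n) c).symm y :=
    (contMDiffOn_extChartAt_symm c).contMDiffAt ((isOpen_extChartAt_target c).mem_nhds hy)
  exact ((contMDiffAt_extChartAt' (by simpa using hz)).comp y h2).contDiffAt

lemma mfderiv_extChartAt_symm_eq_comp {c z : M} {y : EuclideanSpace ℝ (Fin n)}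
    (hy : y ∈ (extChartAt (𝓡 n) c).target)
    (hz : (extChartAt (𝓡 n) c).symm y ∈ (extChartAt (𝓡 n) z).source) :
    (mfderiv 𝓘(ℝ, EuclideanSpace ℝ (Fin n)) (𝓡 n) (extChartAt (𝓡 n) c).symm y :
      EuclideanSpace ℝ (Fin n) →L[ℝ] EuclideanSpace ℝ (Fin n)) =
    ContinuousLinearMap.comp (mfderiv 𝓘(ℝ, EuclideanSpace ℝ (Fin n)) (𝓡 n)
      (extChartAt (𝓡 n) z).symm (transition n c z y) :
      EuclideanSpace ℝ (Fin n) →L[ℝ] EuclideanSpace ℝ (Fin n)) (fderiv ℝ (transition n c z) y) := by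
  have h1 : (extChartAt (𝓡 n) c).symm =ᶠ[𝓝 y]
      (extChartAt (𝓡 n) z).symm ∘ transition n c z := by
    have hc : ContinuousAt (extChartAt (𝓡 n) c).symm y :=
      (mdifferentiableAt_extChartAt_symm hy).continuousAt
    filter_upwards [hc.preimage_mem_nhds ((isOpen_extChartAt_source z).mem_nhds hz)] with w hw
    exact ((extChartAt (𝓡 n) z).left_inv hw).symm
  rw [h1.mfderiv_eq, mfderiv_comp y (mdifferentiableAt_extChartAt_symm
    ((extChartAt (𝓡 n) z).map_source hz))
    ((contDiffAt_transition hy hz).differentiableAt (by simp)).mdifferentiableAt, mfderiv_eq_fderiv]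
  rfl

lemma coord_eq_comp_transition (α : OneForm n M) {c z : M} {y : EuclideanSpace ℝ (Fin n)}
    (hy : y ∈ (extChartAt (𝓡 n) c).target)
    (hz : (extChartAt (𝓡 n) c).symm y ∈ (extChartAt (𝓡 n) z).source) :
    coord α c y = (coord α z (transition n c z y)).comp (fderiv ℝ (transition n c z) y) := by
  have h1 : (extChartAt (𝓡 n) z).symm (transition n c z y) = (extChartAt (𝓡 n) c).symm y :=
    (extChartAt (𝓡 n) z).left_inv hz
  let a : M → EuclideanSpace ℝ (Fin n) →L[ℝ] ℝ := fun x => α x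
  change (a _).comp _ = ((a ((extChartAt (𝓡 n) z).symm (transition n c z y))).comp _).comp _
  rw [h1, mfderiv_extChartAt_symm_eq_comp hy hz]
  rfl

/-- At a zero, the Hessians in two charts are congruent. -/
lemma exists_fderiv_coord_eq_hessian (α : OneForm n M) {c z : M}
    (hz : z ∈ (extChartAt (𝓡 n) c).source) (h0 : α z = 0) :
    ∃ L : EuclideanSpace ℝ (Fin n) ≃L[ℝ] EuclideanSpace ℝ (Fin n), ∀ v w,
      fderiv ℝ (coord α c) (extChartAt (𝓡 n) c z) v w = hessian α z (L v) (L w) := by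
  set y := extChartAt (𝓡 n) c z with hy
  have hyt : y ∈ (extChartAt (𝓡 n) c).target := (extChartAt (𝓡 n) c).map_source hz
  have hys : (extChartAt (𝓡 n) c).symm y = z := (extChartAt (𝓡 n) c).left_inv hz
  have hyz : (extChartAt (𝓡 n) c).symm y ∈ (extChartAt (𝓡 n) z).source := by
    rw [hys]; exact mem_extChartAt_source z
  have hφy : transition n c z y = extChartAt (𝓡 n) z z := by
    rw [transition, Function.comp_apply, hys]
  have hL : (fderiv ℝ (transition n c z) y).IsInvertible := by
    obtain ⟨A, hA⟩ := exists_equiv_eq_mfderiv_extChartAt_symm hyt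
    obtain ⟨B, hB⟩ := exists_equiv_eq_mfderiv_extChartAt_symm
      ((extChartAt (𝓡 n) z).map_source hyz)
    have h := mfderiv_extChartAt_symm_eq_comp hyt hyz
    rw [← hA, transition, Function.comp_apply, ← hB] at h
    -- The derivative of the transition map is the quotient of the two invertible derivatives of the
    -- inverse charts.
    refine ⟨A.trans B.symm, ?_⟩
    ext1 v
    have h2 := congrArg (fun f => f v) h
    change B.symm (A v) = _
    rw [ContinuousLinearEquiv.symm_apply_eq]
    exact h2
  obtain ⟨L, hL⟩ := hL
  refine ⟨L, fun v w => ?_⟩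
  have hev : coord α c =ᶠ[𝓝 y] fun y' =>
      (coord α z (transition n c z y')).comp (fderiv ℝ (transition n c z) y') := by
    have hc : ContinuousAt (extChartAt (𝓡 n) c).symm y :=
      (mdifferentiableAt_extChartAt_symm hyt).continuousAt
    filter_upwards [hc.preimage_mem_nhds ((isOpen_extChartAt_source z).mem_nhds hyz),
      (isOpen_extChartAt_target c).mem_nhds hyt] with w hw hw'
    exact coord_eq_comp_transition α hw' hw
  have hφ := contDiffAt_transition hyt hyz
  have hd1 : HasFDerivAt (fun y' => coord α z (transition n c z y'))
      ((fderiv ℝ (coord α z) (transition n c z y)).comp (fderiv ℝ (transition n c z) y)) y := by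
    refine HasFDerivAt.comp (g := coord α z) y ?_ (hφ.differentiableAt (by simp)).hasFDerivAt
    refine (differentiableAt_coord α z ?_).hasFDerivAt
    rw [hφy]; exact mem_extChartAt_target z
  have hd2 := ((hφ.fderiv_right (m := ∞) (by simp)).differentiableAt (by simp)).hasFDerivAt
  have h3 := hd1.clm_comp hd2
  -- The product rule produces a term with the second derivative of the transition map, multiplied
  -- by the value of the form; it disappears at a zero, leaving a congruence.
  have hzero : coord α z (transition n c z y) = 0 := by
    rw [hφy]
    exact (coord_eq_zero_iff α (mem_extChartAt_target z)).2 (by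
      rw [extChartAt_to_inv]; exact h0)
  rw [hev.fderiv_eq, h3.fderiv, hessian, ← hφy]
  change coord α z (transition n c z y) (fderiv ℝ (fderiv ℝ (transition n c z)) y v w) +
    fderiv ℝ (coord α z) (transition n c z y) (fderiv ℝ (transition n c z) y v)
      (fderiv ℝ (transition n c z) y w) = _
  rw [hzero, zero_apply, zero_add, ← hL]
  rfl

/-- Non-degeneracy of the Hessian can be tested in any chart. -/
lemma hessian_nondegenerate_iff (α : closedForms n M) {c z : M}
    (hz : z ∈ (extChartAt (𝓡 n) c).source) (h0 : (α : OneForm n M) z = 0) :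
    (hessian (α : OneForm n M) z).Nondegenerate ↔
      Function.Injective (fderiv ℝ (coord (α : OneForm n M) c) (extChartAt (𝓡 n) c z)) := by
  obtain ⟨L, hL⟩ := exists_fderiv_coord_eq_hessian (α : OneForm n M) hz h0
  rw [hessian, nondegenerate_iff_of_symm (α.2 z _ (mem_extChartAt_target z))]
  have : ∀ v, fderiv ℝ (coord (α : OneForm n M) c) (extChartAt (𝓡 n) c z) v = 0 ↔
      fderiv ℝ (coord (α : OneForm n M) z) (extChartAt (𝓡 n) z z) (L v) = 0 := by
    intro v
    constructor
    · intro h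
      ext w
      have := hL v (L.symm w)
      rw [h, L.apply_symm_apply] at this
      exact this.symm
    · intro h
      ext w
      rw [hL v w]
      change fderiv ℝ (coord (α : OneForm n M) z) (extChartAt (𝓡 n) z z) (L v) (L w) = _
      rw [h]; rfl
  rw [injective_iff_map_eq_zero, injective_iff_map_eq_zero]
  constructor
  · intro h v hv
    exact L.map_eq_zero_iff.1 (h _ ((this v).1 hv))
  · intro h v hv
    have := h (L.symm v) ((this _).2 (by rwa [L.apply_symm_apply]))
    exact L.symm.map_eq_zero_iff.1 this

/-- The Morse index can be computed in any chart. -/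
lemma morseIndex_eq (α : closedForms n M) {c z : M}
    (hz : z ∈ (extChartAt (𝓡 n) c).source) (h0 : (α : OneForm n M) z = 0) :
    morseIndex α z = sigNeg (fderiv ℝ (coord (α : OneForm n M) c)
      (extChartAt (𝓡 n) c z)).toBilinForm.toQuadraticMap := by
  obtain ⟨L, hL⟩ := exists_fderiv_coord_eq_hessian (α : OneForm n M) hz h0
  refine (QuadraticMap.Equivalent.sigNeg_eq ⟨⟨L.toLinearEquiv, fun v => ?_⟩⟩).symm
  exact (hL v v).symm

end Coordinates

/-! ### Differentials of functions as closed forms -/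

section Exact

variable {f : M → ℝ}

/-- The differential of a smooth function, as a smooth 1-form. -/
def dOneForm (f : M → ℝ) (hf : ContMDiff (𝓡 n) 𝓘(ℝ, ℝ) ∞ f) : OneForm n M where
  toFun x := mfderiv (𝓡 n) 𝓘(ℝ, ℝ) f x
  contMDiff_toFun := by
    intro x₀
    refine (contMDiffAt_hom_bundle _).2 ⟨contMDiffAt_id, ?_⟩
    convert (hf x₀).mfderiv_const (m := ∞) (by simp) using 2 with x
    ext v
    simp [inTangentCoordinates, ContinuousLinearMap.inCoordinates]
    rfl

lemma dOneForm_add {g : M → ℝ} (hf : ContMDiff (𝓡 n) 𝓘(ℝ, ℝ) ∞ f)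
    (hg : ContMDiff (𝓡 n) 𝓘(ℝ, ℝ) ∞ g) :
    dOneForm (f + g) (hf.add hg) = dOneForm f hf + dOneForm g hg := by
  ext1 x
  exact mfderiv_add (hf.mdifferentiableAt (by simp)) (hg.mdifferentiableAt (by simp))

lemma dOneForm_smul (r : ℝ) (hf : ContMDiff (𝓡 n) 𝓘(ℝ, ℝ) ∞ f) :
    dOneForm (r • f) (by exact (contMDiff_const (c := r)).mul hf) = r • dOneForm f hf := by
  ext1 x
  exact const_smul_mfderiv (hf.mdifferentiableAt (by simp)) r

lemma coord_dOneForm (hf : ContMDiff (𝓡 n) 𝓘(ℝ, ℝ) ∞ f) {c : M} {y : EuclideanSpace ℝ (Fin n)}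
    (hy : y ∈ (extChartAt (𝓡 n) c).target) :
    coord (dOneForm f hf) c y = fderiv ℝ (f ∘ (extChartAt (𝓡 n) c).symm) y := by
  rw [← mfderiv_eq_fderiv, mfderiv_comp y (hf.mdifferentiableAt (by simp))
    (mdifferentiableAt_extChartAt_symm hy)]
  rfl

/-- The differential of a smooth function, as a closed form. -/
def dClosed (f : M → ℝ) (hf : ContMDiff (𝓡 n) 𝓘(ℝ, ℝ) ∞ f) : closedForms n M :=
  ⟨dOneForm f hf, by
    intro c y hy v w
    have hev : coord (dOneForm f hf) c =ᶠ[𝓝 y] fderiv ℝ (f ∘ (extChartAt (𝓡 n) c).symm) := by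
      filter_upwards [(isOpen_extChartAt_target (I := 𝓡 n) c).mem_nhds hy] with z hz
      exact coord_dOneForm hf hz
    rw [hev.fderiv_eq]
    have h2 : ContMDiffAt 𝓘(ℝ, EuclideanSpace ℝ (Fin n)) (𝓡 n) ∞ (extChartAt (𝓡 n) c).symm y :=
      (contMDiffOn_extChartAt_symm c).contMDiffAt ((isOpen_extChartAt_target c).mem_nhds hy)
    have h3 : ContDiffAt ℝ ∞ (f ∘ (extChartAt (𝓡 n) c).symm) y :=
      ((hf _).comp y h2).contDiffAt
    exact (h3.isSymmSndFDerivAt (by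
      rw [minSmoothness_of_isRCLikeNormedField]
      exact WithTop.coe_le_coe.2 (le_top : (2 : ℕ∞) ≤ ⊤))).eq v w⟩

lemma mkQ_dClosed (hf : ContMDiff (𝓡 n) 𝓘(ℝ, ℝ) ∞ f) :
    (exactForms n M).mkQ (dClosed f hf) = 0 :=
  (Submodule.Quotient.mk_eq_zero _).2 ⟨f, hf, fun _ => rfl⟩

end Exact

/-! ### Families of forms continuous in the `C¹` sense -/

section Families

variable {W : Type*} [TopologicalSpace W]

/-- A family of 1-forms that is continuous for the `C¹` topology: in every chart the coefficients
and their derivatives depend continuously on the parameter and the point. -/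
structure IsC1Family (F : W → OneForm n M) : Prop where
  coord (c : M) : ContinuousOn (fun p : W × EuclideanSpace ℝ (Fin n) =>
    MorseComplexity.coord (F p.1) c p.2) (univ ×ˢ (extChartAt (𝓡 n) c).target)
  fderiv (c : M) : ContinuousOn (fun p : W × EuclideanSpace ℝ (Fin n) =>
    _root_.fderiv ℝ (MorseComplexity.coord (F p.1) c) p.2) (univ ×ˢ (extChartAt (𝓡 n) c).target)

variable (n) in
/-- The coefficients of a form in a chart. -/
def coordMap (c : M) : OneForm n M →ₗ[ℝ]
    C((extChartAt (𝓡 n) c).target, EuclideanSpace ℝ (Fin n) →L[ℝ] ℝ) where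
  toFun α := ⟨fun y => coord α c y, (continuousOn_coord α c).domRestrict⟩
  map_add' α β := by ext1 y; exact congrFun (coord_add α β c) y
  map_smul' r α := by ext1 y; exact congrFun (coord_smul r α c) y

variable (n) in
/-- The derivative of the coefficients of a form in a chart. -/
def fderivCoordMap (c : M) :
    OneForm n M →ₗ[ℝ] C((extChartAt (𝓡 n) c).target,
      EuclideanSpace ℝ (Fin n) →L[ℝ] EuclideanSpace ℝ (Fin n) →L[ℝ] ℝ) where
  toFun α := ⟨fun y => fderiv ℝ (coord α c) y, (continuousOn_fderiv_coord α c).domRestrict⟩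
  map_add' α β := by
    ext1 y
    change fderiv ℝ (coord (α + β) c) y = fderiv ℝ (coord α c) y + fderiv ℝ (coord β c) y
    rw [coord_add, fderiv_add (differentiableAt_coord α c y.2) (differentiableAt_coord β c y.2)]
  map_smul' r α := by
    ext1 y
    change fderiv ℝ (coord (r • α) c) y = r • fderiv ℝ (coord α c) y
    rw [coord_smul, fderiv_const_smul (differentiableAt_coord α c y.2)]

/-- Evaluation is jointly continuous for the compact-open topology over a locally compact space. -/
lemma continuousOn_of_continuous_continuousMap {X Y Z : Type*} [TopologicalSpace X]
    [TopologicalSpace Y] [TopologicalSpace Z] {s : Set Y} [LocallyCompactSpace s] {g : X → Y → Z}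
    {G : X → C(s, Z)} (hG : Continuous G) (hg : ∀ x (y : s), G x y = g x y) :
    ContinuousOn (fun p : X × Y => g p.1 p.2) (univ ×ˢ s) := by
  rw [continuousOn_iff_continuous_domRestrict]
  have h : Continuous fun p : (univ ×ˢ s : Set (X × Y)) => G p.1.1 ⟨p.1.2, p.2.2⟩ := by
    have h1 : Continuous fun p : (univ ×ˢ s : Set (X × Y)) => (⟨p.1.2, p.2.2⟩ : s) := by fun_prop
    have h2 : Continuous fun p : (univ ×ˢ s : Set (X × Y)) => G p.1.1 := by fun_prop
    exact h2.eval h1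
  convert h using 2 with p
  exact (hg p.1.1 ⟨p.1.2, p.2.2⟩).symm

/-- A linear family of forms over a real vector space with its module topology is `C¹`
continuous. -/
lemma IsC1Family.of_linearMap [AddCommGroup W] [Module ℝ W] [IsModuleTopology ℝ W]
    (L : W →ₗ[ℝ] OneForm n M) : IsC1Family L := by
  have hl : ∀ c : M, LocallyCompactSpace (extChartAt (𝓡 n) c).target := fun c =>
    (isOpen_extChartAt_target (I := 𝓡 n) c).locallyCompactSpace
  refine ⟨fun c => ?_, fun c => ?_⟩
  -- Linear maps from a module topology into a topological vector space are automatically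
  -- continuous; here the target is a space of continuous maps.
  · refine continuousOn_of_continuous_continuousMap (g := fun w y => MorseComplexity.coord (L w) c y)
      (IsModuleTopology.continuous_of_linearMap
      (coordMap n c ∘ₗ L)) fun _ _ => rfl
  · refine continuousOn_of_continuous_continuousMap
      (g := fun w y => _root_.fderiv ℝ (MorseComplexity.coord (L w) c) y)
      (IsModuleTopology.continuous_of_linearMap
      (fderivCoordMap n c ∘ₗ L)) fun _ _ => rfl

lemma IsC1Family.const_add {F : W → OneForm n M} (hF : IsC1Family F) (α : OneForm n M) :
    IsC1Family fun w => α + F w := by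
  refine ⟨fun c => ?_, fun c => ?_⟩
  · simp only [coord_add]
    exact ((continuousOn_coord α c).comp continuousOn_snd fun p hp => hp.2).add (hF.coord c)
  · refine ContinuousOn.congr (((continuousOn_fderiv_coord α c).comp continuousOn_snd
      fun p hp => hp.2).add (hF.fderiv c)) fun p hp => ?_
    simp only [coord_add]
    exact fderiv_add (differentiableAt_coord α c hp.2) (differentiableAt_coord _ c hp.2)

lemma IsC1Family.comp {W' : Type*} [TopologicalSpace W'] {F : W → OneForm n M}
    (hF : IsC1Family F) {g : W' → W} (hg : Continuous g) : IsC1Family fun w => F (g w) := by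
  refine ⟨fun c => ?_, fun c => ?_⟩
  · exact (hF.coord c).comp (f := fun p : W' × EuclideanSpace ℝ (Fin n) => (g p.1, p.2))
      (by fun_prop) fun p hp => ⟨mem_univ _, hp.2⟩
  · exact (hF.fderiv c).comp (f := fun p : W' × EuclideanSpace ℝ (Fin n) => (g p.1, p.2))
      (by fun_prop) fun p hp => ⟨mem_univ _, hp.2⟩

end Families

/-! ### Stability of non-degenerate zeros -/

section Stability

/-- All zeros of `α` in `s` are non-degenerate. -/
def IsMorseOn (α : closedForms n M) (s : Set M) : Prop :=
  ∀ z ∈ s, (α : OneForm n M) z = 0 → (hessian (α : OneForm n M) z).Nondegenerate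

variable {W : Type*} [TopologicalSpace W] {F : W → closedForms n M} {w₀ : W}

/-- Zeros near a non-degenerate point are non-degenerate, at most one in number, and have the same
index, uniformly for `C¹`-close closed forms. -/
lemma exists_nhds_eventually_zeros (hF : IsC1Family fun w => (F w : OneForm n M)) {x : M}
    (hx : (F w₀ : OneForm n M) x = 0 → (hessian (F w₀ : OneForm n M) x).Nondegenerate) :
    ∃ V ∈ 𝓝 x, ∀ᶠ w in 𝓝 w₀, ∀ z ∈ V, (F w : OneForm n M) z = 0 →
      (hessian (F w : OneForm n M) z).Nondegenerate ∧ (F w₀ : OneForm n M) x = 0 ∧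
      morseIndex (F w) z = morseIndex (F w₀) x ∧
      ∀ z' ∈ V, (F w : OneForm n M) z' = 0 → z = z' := by
  set y₀ := extChartAt (𝓡 n) x x with hy₀
  have hy₀t : y₀ ∈ (extChartAt (𝓡 n) x).target := mem_extChartAt_target x
  have hnhds : (univ ×ˢ (extChartAt (𝓡 n) x).target : Set (W × _)) ∈ 𝓝 (w₀, y₀) :=
    prod_mem_nhds univ_mem ((isOpen_extChartAt_target x).mem_nhds hy₀t)
  have hA := (hF.coord x).continuousAt hnhds
  have hD := (hF.fderiv x).continuousAt hnhds
  have zero_iff : ∀ w, ∀ z ∈ (extChartAt (𝓡 n) x).source, (F w : OneForm n M) z = 0 ↔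
      coord (F w : OneForm n M) x (extChartAt (𝓡 n) x z) = 0 := fun w z hz => by
    rw [coord_eq_zero_iff _ ((extChartAt (𝓡 n) x).map_source hz), (extChartAt (𝓡 n) x).left_inv hz]
  by_cases h0 : (F w₀ : OneForm n M) x = 0
  · have hinj := (hessian_nondegenerate_iff (F w₀) (mem_extChartAt_source x) h0).1 (hx h0)
    -- One `ε` serves twice: it makes each nearby derivative injective, hence zeros non-degenerate,
    -- and the coefficient map injective on a ball, hence zeros unique.
    obtain ⟨ε, hε, hε1, hε2⟩ := exists_injective_of_dist_le hinj
    have h1 := hD.eventually (Metric.closedBall_mem_nhds _ hε)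
    have h2 := hD.eventually (eventually_sigNeg_eq ((F w₀).2 x _ hy₀t) hinj)
    obtain ⟨r, hrt, hr, hev⟩ := exists_ball_eventually_forall (h1.and h2)
    refine ⟨_, hr, ?_⟩
    filter_upwards [hev] with w hw z hz hz0
    have hw' : ∀ y ∈ Metric.ball y₀ r, ‖fderiv ℝ (coord (F w : OneForm n M) x) y -
        fderiv ℝ (coord (F w₀ : OneForm n M) x) y₀‖ ≤ ε := fun y hy => by
      simpa [dist_eq_norm] using (hw y hy).1
    refine ⟨(hessian_nondegenerate_iff (F w) hz.1 hz0).2 (hε1 _ (hw' _ hz.2)), h0, ?_, ?_⟩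
    · rw [morseIndex_eq (F w) hz.1 hz0, morseIndex_eq (F w₀) (mem_extChartAt_source x) h0]
      exact (hw _ hz.2).2
    · intro z' hz' hz0'
      refine (extChartAt (𝓡 n) x).injOn hz.1 hz'.1 ?_
      refine hε2 (coord (F w : OneForm n M) x) _ (convex_ball y₀ r)
        (fun y hy => differentiableAt_coord _ x (hrt hy)) hw' hz.2 hz'.2 ?_
      rw [(zero_iff w z hz.1).1 hz0, (zero_iff w z' hz'.1).1 hz0']
  · have h1 := hA.eventually_ne (fun h => h0 ((zero_iff w₀ x (mem_extChartAt_source x)).2 h))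
    obtain ⟨r, hrt, hr, hev⟩ := exists_ball_eventually_forall h1
    refine ⟨_, hr, ?_⟩
    filter_upwards [hev] with w hw z hz hz0
    exact absurd ((zero_iff w z hz.1).1 hz0) (hw _ hz.2)

/-- Being Morse on a compact set is a `C¹`-open condition. -/
lemma eventually_isMorseOn (hF : IsC1Family fun w => (F w : OneForm n M)) {K : Set M}
    (hK : IsCompact K) (h : IsMorseOn (F w₀) K) : ∀ᶠ w in 𝓝 w₀, IsMorseOn (F w) K := by
  choose! V hV hVe using fun x (hx : x ∈ K) => exists_nhds_eventually_zeros hF (h x hx)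
  obtain ⟨t, htK, hcov⟩ := hK.elim_nhds_subcover V hV
  filter_upwards [(Finset.eventually_all t).2 fun x hx => hVe x (htK x hx)] with w hw z hz hz0
  obtain ⟨x, hx, hzx⟩ := mem_iUnion₂.1 (hcov hz)
  exact (hw x hx z hzx hz0).1

/-- Zeros of a Morse form on a compact manifold are finite in number. -/
lemma IsMorse.finite_zeros [CompactSpace M] {α : closedForms n M} (h : IsMorse α) :
    {z : M | (α : OneForm n M) z = 0}.Finite := by
  -- With a constant family, the perturbation lemma says that the zeros of `α` itself are isolated.
  have hF : IsC1Family fun _ : Unit => (α : OneForm n M) := by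
    refine ⟨fun c => (continuousOn_coord _ c).comp continuousOn_snd fun p hp => hp.2,
      fun c => (continuousOn_fderiv_coord _ c).comp continuousOn_snd fun p hp => hp.2⟩
  choose V hV hVe using fun x : M =>
    exists_nhds_eventually_zeros (F := fun _ : Unit => α) (w₀ := ()) hF (h x)
  obtain ⟨t, -, hcov⟩ := isCompact_univ.elim_nhds_subcover V fun x _ => hV x
  refine (t.finite_toSet.biUnion (t := fun x => V x ∩ {z | (α : OneForm n M) z = 0})
    fun x hx => Set.Subsingleton.finite ?_).subset fun z hz => ?_
  · rintro z ⟨hz, hz0⟩ z' ⟨hz', hz0'⟩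
    exact ((hVe x).self_of_nhds z hz hz0).2.2.2 z' hz' hz0'
  · obtain ⟨x, hx, hzx⟩ := mem_iUnion₂.1 (hcov (mem_univ z))
    exact mem_iUnion₂.2 ⟨x, hx, hzx, hz⟩

/-- A `C¹`-small closed perturbation of a Morse form is Morse and has at most as many zeros of each
index. -/
lemma eventually_isMorse_and_complexityVector_le [CompactSpace M]
    (hF : IsC1Family fun w => (F w : OneForm n M)) (h : IsMorse (F w₀)) :
    ∀ᶠ w in 𝓝 w₀, IsMorse (F w) ∧ complexityVector (F w) ≤ complexityVector (F w₀) := by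
  choose V hV hVe using fun x : M => exists_nhds_eventually_zeros hF (h x)
  obtain ⟨t, -, hcov⟩ := isCompact_univ.elim_nhds_subcover V fun x _ => hV x
  have hcov' : ∀ z : M, ∃ x ∈ t, z ∈ V x := fun z => by simpa using hcov (mem_univ z)
  -- `p` sends a point to the centre of a chosen patch containing it. On zeros of the perturbed form
  -- it is injective, and it lands on zeros of `F w₀` with the same index.
  choose p hp hpV using hcov'
  filter_upwards [(Finset.eventually_all t).2 fun x _ => hVe x] with w hw
  refine ⟨fun z hz => (hw _ (hp z) z (hpV z) hz).1, Pi.toLex_monotone fun i => ?_⟩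
  refine ncard_le_ncard_of_injOn p ?_ ?_ (h.finite_zeros.subset fun z hz => hz.1)
  · rintro z ⟨hz, hi⟩
    obtain ⟨-, h1, h2, -⟩ := hw _ (hp z) z (hpV z) hz
    exact ⟨h1, h2 ▸ hi⟩
  · rintro z ⟨hz, -⟩ z' ⟨hz', -⟩ hzz'
    exact (hw _ (hp z) z (hpV z) hz).2.2.2 z' (hzz' ▸ hpV z') hz'

end Stability

/-! ### Morse representatives of every class -/

section Existence

lemma contMDiff_bump_inner [T2Space M] {c : M} (b : SmoothBumpFunction (𝓡 n) c)
    (e : EuclideanSpace ℝ (Fin n)) :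
    ContMDiff (𝓡 n) 𝓘(ℝ, ℝ) ∞ fun x => b x • innerSL ℝ e (extChartAt (𝓡 n) c x) :=
  b.contMDiff_smul ((innerSL ℝ e).contMDiff.comp_contMDiffOn contMDiffOn_extChartAt)

/-- The exact forms `d (b ⟪e, x⟫)`, with `b` a bump function and `x` the coordinates of a chart. -/
def bumpForm [T2Space M] {c : M} (b : SmoothBumpFunction (𝓡 n) c) :
    EuclideanSpace ℝ (Fin n) →ₗ[ℝ] OneForm n M where
  toFun e := dOneForm _ (contMDiff_bump_inner b e)
  map_add' e e' := by
    rw [← dOneForm_add]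
    congr 1
    ext x
    simp [mul_add]
  map_smul' r e := by
    rw [RingHom.id_apply, ← dOneForm_smul]
    congr 1
    ext x
    simp [mul_left_comm]

/-- Near points where `b` is locally 1 the form is `d ⟪e, x⟫`, which has constant coefficients. -/
lemma coord_bumpForm [T2Space M] {c : M} (b : SmoothBumpFunction (𝓡 n) c)
    (e : EuclideanSpace ℝ (Fin n)) {y : EuclideanSpace ℝ (Fin n)}
    (hy : y ∈ (extChartAt (𝓡 n) c).target)
    (hb : ∀ᶠ x in 𝓝 ((extChartAt (𝓡 n) c).symm y), b x = 1) :
    coord (bumpForm b e) c =ᶠ[𝓝 y] fun _ => innerSL ℝ e := by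
  have hc : ContinuousAt (extChartAt (𝓡 n) c).symm y :=
    (mdifferentiableAt_extChartAt_symm hy).continuousAt
  filter_upwards [(hc.eventually hb).eventually_nhds,
    (isOpen_extChartAt_target (I := 𝓡 n) c).eventually_mem hy] with w hw hwt
  have h1 : (fun x => b x • innerSL ℝ e (extChartAt (𝓡 n) c x)) ∘ (extChartAt (𝓡 n) c).symm
      =ᶠ[𝓝 w] innerSL ℝ e := by
    filter_upwards [hw, (isOpen_extChartAt_target (I := 𝓡 n) c).eventually_mem hwt] with u hu hut
    rw [Function.comp_apply, hu, one_smul, (extChartAt (𝓡 n) c).right_inv hut]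
  exact (coord_dOneForm (contMDiff_bump_inner b e) hwt).trans
    (h1.fderiv_eq.trans (innerSL ℝ e).fderiv)

/-- A closed form can be made Morse near a point by an exact perturbation, keeping it Morse on a
given compact set. -/
lemma exists_nhds_isMorseOn_union [T2Space M] (c : M) :
    ∃ U ∈ 𝓝 c, ∀ (α : closedForms n M) (K : Set M), IsCompact K → IsMorseOn α K →
      ∃ β : closedForms n M, (exactForms n M).mkQ β = (exactForms n M).mkQ α ∧
        IsMorseOn β (K ∪ U) := by
  obtain ⟨b⟩ : Nonempty (SmoothBumpFunction (𝓡 n) c) := inferInstance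
  -- `b` must be 1 around each point of `U`, not only at it, so that the perturbation leaves the
  -- derivative of the coefficients unchanged.
  refine ⟨{x | (∀ᶠ x' in 𝓝 x, b x' = 1) ∧ x ∈ (extChartAt (𝓡 n) c).source},
    b.eventuallyEq_one.eventually_nhds.and (extChartAt_source_mem_nhds c), fun α K hK hα => ?_⟩
  have := isModuleTopologyOfFiniteDimensional (𝕜 := ℝ) (E := EuclideanSpace ℝ (Fin n))
  set F : EuclideanSpace ℝ (Fin n) → closedForms n M := fun e =>
    α + dClosed _ (contMDiff_bump_inner b e) with hF
  have hF1 : IsC1Family fun e => (F e : OneForm n M) :=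
    (IsC1Family.of_linearMap (bumpForm b)).const_add (α : OneForm n M)
  have hF0 : F 0 = α := by
    refine Subtype.ext ?_
    change (α : OneForm n M) + bumpForm b 0 = α
    rw [map_zero, add_zero]
  have hev := eventually_isMorseOn (w₀ := 0) hF1 hK (by rwa [hF0])
  -- The Sard-generic `e` are dense, and those keeping the form Morse on `K` form a neighbourhood of
  -- 0.
  obtain ⟨e, heK, he⟩ := (dense_forall_injective_fderiv fun y hy =>
    differentiableAt_coord (α : OneForm n M) c hy).inter_nhds_nonempty hev
  refine ⟨F e, ?_, ?_⟩
  · rw [hF, map_add, mkQ_dClosed, add_zero]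
  · rintro z (hz | ⟨hzb, hzs⟩) hz0
    · exact he z hz hz0
    · have hyt := (extChartAt (𝓡 n) c).map_source hzs
      have hys := (extChartAt (𝓡 n) c).left_inv hzs
      have hb := coord_bumpForm b e hyt (by rwa [hys])
      have hcF : coord (F e : OneForm n M) c =
        coord (α : OneForm n M) c + coord (bumpForm b e) c := coord_add _ _ c
      have h2 : fderiv ℝ (coord (F e : OneForm n M) c) (extChartAt (𝓡 n) c z) =
          fderiv ℝ (coord (α : OneForm n M) c) (extChartAt (𝓡 n) c z) := by
        rw [hcF, fderiv_add (differentiableAt_coord _ c hyt) (differentiableAt_coord _ c hyt),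
          hb.fderiv_eq, fderiv_fun_const]
        exact add_zero _
      rw [hessian_nondegenerate_iff _ hzs hz0, h2]
      refine heK _ hyt ?_
      have h3 := (coord_eq_zero_iff (F e : OneForm n M) hyt).2 (by rwa [hys])
      rw [hcF, Pi.add_apply, hb.self_of_nhds] at h3
      exact h3

/-- On a compact manifold every cohomology class contains a Morse form. -/
lemma exists_isMorse [T2Space M] [CompactSpace M] (α : closedForms n M) :
    ∃ β : closedForms n M, (exactForms n M).mkQ β = (exactForms n M).mkQ α ∧ IsMorse β := by
  -- The already treated compact set `K` is part of the induction statement, so that two pieces can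
  -- be handled one after the other.
  have key : ∀ (α : closedForms n M) (K : Set M), IsCompact K → IsMorseOn α K →
      ∃ β : closedForms n M, (exactForms n M).mkQ β = (exactForms n M).mkQ α ∧
        ∃ K', IsCompact K' ∧ K ∪ univ ⊆ K' ∧ IsMorseOn β K' := by
    refine isCompact_univ.induction_on (p := fun s => ∀ (α : closedForms n M) (K : Set M),
      IsCompact K → IsMorseOn α K →
      ∃ β : closedForms n M, (exactForms n M).mkQ β = (exactForms n M).mkQ α ∧
        ∃ K', IsCompact K' ∧ K ∪ s ⊆ K' ∧ IsMorseOn β K') ?_ ?_ ?_ ?_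
    · intro α K hK hα
      exact ⟨α, rfl, K, hK, by simp, hα⟩
    · intro s t hst ht α K hK hα
      obtain ⟨β, hβ, K', hK', hsub, hm⟩ := ht α K hK hα
      exact ⟨β, hβ, K', hK', (union_subset_union_right K hst).trans hsub, hm⟩
    · intro s t hs ht α K hK hα
      obtain ⟨β, hβ, K', hK', hsub, hm⟩ := hs α K hK hα
      obtain ⟨γ, hγ, K'', hK'', hsub', hm'⟩ := ht β K' hK' hm
      refine ⟨γ, hγ.trans hβ, K'', hK'', ?_, hm'⟩
      rw [← union_assoc]
      exact (union_subset_union_left t hsub).trans hsub'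
    · intro x _
      obtain ⟨U, hU, h⟩ := exists_nhds_isMorseOn_union (n := n) x
      obtain ⟨C, hC, hCU, hCc⟩ := local_compact_nhds hU
      refine ⟨C, mem_nhdsWithin_of_mem_nhds hC, fun α K hK hα => ?_⟩
      obtain ⟨β, hβ, hm⟩ := h α K hK hα
      exact ⟨β, hβ, K ∪ C, hK.union hCc, subset_rfl,
        fun z hz => hm z (union_subset_union_right K hCU hz)⟩
  obtain ⟨β, hβ, K', -, hsub, hm⟩ := key α ∅ isCompact_empty fun z hz => absurd hz (notMem_empty z)
  exact ⟨β, hβ, fun z => hm z (hsub (Or.inr (mem_univ z)))⟩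

end Existence

/-! ### Semicontinuity of the complexity and the non-singular case -/

section Complexity

lemma isLeast_classComplexity [T2Space M] [CompactSpace M] (ξ : H1 n M) :
    IsLeast (morseVectors ξ) (classComplexity ξ) := by
  have hne : (morseVectors ξ).Nonempty := by
    obtain ⟨α, rfl⟩ := (exactForms n M).mkQ_surjective ξ
    obtain ⟨β, hβ, hm⟩ := exists_isMorse α
    exact ⟨_, β, hm, hβ, rfl⟩
  rw [classComplexity, dif_pos hne]
  exact ⟨WellFounded.min_mem _ _ hne, fun v hv => not_lt.1 (WellFounded.not_lt_min _ _ hv)⟩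

instance : IsModuleTopology ℝ (H1 n M) := ⟨rfl⟩

/-- The complexity of a class is upper semicontinuous. -/
lemma isOpen_setOf_classComplexity_le [T2Space M] [CompactSpace M]
    (v : Lex (Fin (n + 1) → ℕ)) : IsOpen {ξ : H1 n M | classComplexity ξ ≤ v} := by
  have : ContinuousAdd (H1 n M) := IsModuleTopology.toContinuousAdd ℝ _
  have : Module.Projective ℝ (H1 n M) :=
    Module.Projective.of_basis (Module.Basis.ofVectorSpace ℝ (H1 n M))
  -- A vector space is projective, so the projection to `H¹` splits linearly; the module topology on
  -- `H¹` makes `σ` a `C¹`-continuous family.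
  obtain ⟨σ, hσ⟩ := LinearMap.exists_rightInverse_of_surjective (R := ℝ)
    (M := closedForms n M) (P := H1 n M) (exactForms n M).mkQ (Submodule.range_mkQ _)
  refine isOpen_iff_mem_nhds.2 fun ξ₀ hξ₀ => ?_
  obtain ⟨α, hα, hαξ, hαv⟩ := (isLeast_classComplexity ξ₀).1
  set F : H1 n M → closedForms n M := fun ξ => α + σ (ξ - ξ₀) with hF
  have hF1 : IsC1Family fun ξ => (F ξ : OneForm n M) := by
    have h1 := (IsC1Family.of_linearMap ((closedForms n M).subtype ∘ₗ σ)).const_add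
      (α : OneForm n M)
    have h2 : Continuous fun ξ : H1 n M => ξ - ξ₀ := by
      simp only [sub_eq_add_neg]
      exact continuous_id.add continuous_const
    exact h1.comp h2
  have hF0 : F ξ₀ = α := by simp [hF]
  have hmk : ∀ ξ, (exactForms n M).mkQ (F ξ) = ξ := fun ξ => by
    have := LinearMap.congr_fun hσ (ξ - ξ₀)
    rw [hF, map_add, hαξ]
    change ξ₀ + ((exactForms n M).mkQ ∘ₗ σ) (ξ - ξ₀) = ξ
    rw [this]
    simp
  filter_upwards [eventually_isMorse_and_complexityVector_le (w₀ := ξ₀) hF1 (by rwa [hF0])]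
    with ξ hξ
  refine ((isLeast_classComplexity ξ).2 ⟨F ξ, hξ.1, hmk ξ, rfl⟩).trans (hξ.2.trans ?_)
  rw [hF0, hαv]
  exact hξ₀

lemma morseComplexity_rayOfNeZero (ξ : H1 n M) (hξ : ξ ≠ 0) :
    morseComplexity n M (rayOfNeZero ℝ ξ hξ) = classComplexity ξ := rfl

lemma isOpen_setOf_morseComplexity_le [T2Space M] [CompactSpace M]
    (v : Lex (Fin (n + 1) → ℕ)) : IsOpen {ψ : S n M | morseComplexity n M ψ ≤ v} :=
  isOpen_coinduced.2 ((isOpen_setOf_classComplexity_le v).preimage continuous_subtype_val)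

/-- The lexicographic order extends the componentwise one. -/
lemma zero_le_lexVector (v : Lex (Fin (n + 1) → ℕ)) : 0 ≤ v :=
  Pi.toLex_monotone (a := 0) (b := ofLex v) fun _ => Nat.zero_le _

/-- A Morse form on a compact manifold has complexity zero exactly if it has no zeros. -/
lemma complexityVector_eq_zero_iff [CompactSpace M] {α : closedForms n M} (h : IsMorse α) :
    complexityVector α = 0 ↔ ∀ x : M, (α : OneForm n M) x ≠ 0 := by
  constructor
  · intro h0 x hx
    -- Every zero has an index in `0, …, n`, so it is counted by some component of the vector.
    have hle : morseIndex α x ≤ n := by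
      have := QuadraticForm.sigPos_add_sigNeg_add_radical
        (Q := (hessian (α : OneForm n M) x).toQuadraticMap)
      rw [finrank_euclideanSpace_fin] at this
      rw [morseIndex]
      omega
    have h1 : Set.ncard {z : M | (α : OneForm n M) z = 0 ∧ morseIndex α z =
        (⟨morseIndex α x, by omega⟩ : Fin (n + 1))} = 0 := congrFun (congrArg ofLex h0) _
    rw [ncard_eq_zero (h.finite_zeros.subset fun z hz => hz.1)] at h1
    exact (h1 ▸ (⟨hx, rfl⟩ : x ∈ {z : M | (α : OneForm n M) z = 0 ∧ morseIndex α z =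
        (⟨morseIndex α x, by omega⟩ : Fin (n + 1))}) : x ∈ (∅ : Set M))
  · intro h0
    refine congrArg toLex (funext fun i => ?_)
    rw [show {z : M | (α : OneForm n M) z = 0 ∧ morseIndex α z = i} = ∅ from
      eq_empty_of_forall_notMem fun z hz => h0 z hz.1, ncard_empty]

lemma classComplexity_eq_zero_iff [T2Space M] [CompactSpace M] (ξ : H1 n M) :
    classComplexity ξ = 0 ↔ ∃ α : closedForms n M, (exactForms n M).mkQ α = ξ ∧
      ∀ x : M, (α : OneForm n M) x ≠ 0 := by
  constructor
  · intro h
    obtain ⟨α, hα, hαξ, hαv⟩ := (isLeast_classComplexity ξ).1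
    exact ⟨α, hαξ, (complexityVector_eq_zero_iff hα).1 (hαv.trans h)⟩
  · rintro ⟨α, hαξ, h0⟩
    have hα : IsMorse α := fun z hz => absurd hz (h0 z)
    exact le_antisymm ((isLeast_classComplexity ξ).2
      ⟨α, hα, hαξ, (complexityVector_eq_zero_iff hα).2 h0⟩) (zero_le_lexVector _)

end Complexity

end MorseComplexity

end

/-- Let `M` be a closed smooth `n`-manifold.  Every class in `H¹(M; ℝ)` is represented by a Morse
1-form and the lexicographically minimal complexity vector is attained, so that the Morse
complexity `m : S(M) → ℕⁿ⁺¹` is well defined; for every vector `v` the set of rays `ψ` with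
`m ψ ≤ v` is open, so `m` is upper semi-continuous; in particular `m ψ = 0` exactly for the rays
represented by non-singular closed 1-forms, and these form an open set. -/
theorem theorem1 (n : ℕ) (M : Type*) [TopologicalSpace M] [T2Space M] [CompactSpace M]
    [ChartedSpace (EuclideanSpace ℝ (Fin n)) M] [IsManifold (𝓡 n) ∞ M] :
    (∀ (ξ : MorseComplexity.H1 n M) (hξ : ξ ≠ 0),
      IsLeast (MorseComplexity.morseVectors ξ)
        (MorseComplexity.morseComplexity n M (rayOfNeZero ℝ ξ hξ))) ∧
    (∀ v : Lex (Fin (n + 1) → ℕ), ∃ U : Set (MorseComplexity.S n M), IsOpen U ∧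
      ∀ ψ, MorseComplexity.morseComplexity n M ψ ≤ v ↔ ψ ∈ U) ∧
    UpperSemicontinuous (MorseComplexity.morseComplexity n M) ∧
    (∀ (ξ : MorseComplexity.H1 n M) (hξ : ξ ≠ 0),
      MorseComplexity.morseComplexity n M (rayOfNeZero ℝ ξ hξ) = 0 ↔
        ∃ α : MorseComplexity.closedForms n M, (MorseComplexity.exactForms n M).mkQ α = ξ ∧
          ∀ x : M, (α : MorseComplexity.OneForm n M) x ≠ 0) ∧
    IsOpen {ψ : MorseComplexity.S n M | ∃ α : MorseComplexity.closedForms n M,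
      (∀ x : M, (α : MorseComplexity.OneForm n M) x ≠ 0) ∧
      ∃ hα : (MorseComplexity.exactForms n M).mkQ α ≠ 0,
        rayOfNeZero ℝ ((MorseComplexity.exactForms n M).mkQ α) hα = ψ} := by
  refine ⟨fun ξ hξ => MorseComplexity.isLeast_classComplexity ξ, fun v =>
    ⟨_, MorseComplexity.isOpen_setOf_morseComplexity_le v, fun _ => Iff.rfl⟩, ?_,
    fun ξ hξ => MorseComplexity.classComplexity_eq_zero_iff ξ, ?_⟩
  · intro ψ v hv
    -- The sublevel set at the value `m ψ` itself is an open neighbourhood of `ψ`.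
    filter_upwards [(MorseComplexity.isOpen_setOf_morseComplexity_le
      (MorseComplexity.morseComplexity n M ψ)).mem_nhds (mem_ofPred.2 le_rfl)] with φ hφ
    exact lt_of_le_of_lt hφ hv
  · convert MorseComplexity.isOpen_setOf_morseComplexity_le (n := n) (M := M) 0 using 1
    ext ψ
    induction ψ using Module.Ray.ind with
    | h ξ hξ =>
      rw [mem_ofPred, mem_ofPred, MorseComplexity.morseComplexity_rayOfNeZero,
        (MorseComplexity.zero_le_lexVector _).ge_iff_eq']
      constructor
      · rintro ⟨α, h0, hα, hψ⟩
        -- The class of `α` lies on the same ray as `ξ` but need not equal it, so the comparison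
        -- passes through the function on rays.
        rw [← MorseComplexity.morseComplexity_rayOfNeZero ξ hξ, ← hψ]
        exact (MorseComplexity.classComplexity_eq_zero_iff _).2 ⟨α, rfl, h0⟩
      · intro h
        obtain ⟨α, rfl, h0⟩ := (MorseComplexity.classComplexity_eq_zero_iff ξ).1 h
        exact ⟨α, h0, hξ, rfl⟩
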